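/- Let $\mathcal X$ be a finite (nonempty) alphabet and let $\mathcal P_s$ be the set of all stationary (shift-invariant) probability distributions $P$ of two-sided sequences $(X_t)_{t\in\mathbb Z}$ with values in $\mathcal X$. Write $X^n=(X_0,\dots,X_{n-1})$, $X^{-t}=(X_{-t},\dots,X_{-1})$, $X^-=(\dots,X_{-2},X_{-1})$ and $X=X_0$. For probability distributions $\mu,\nu$ let $I(\mu|\nu)=E_\mu\{\log(d\mu/d\nu)\}$ if $\mu$ is dominated by $\nu$, and $I(\mu|\nu)=\infty$ otherwise. For every $n\ge 1$ let $Q(x^n)=Q_n(x^n)$ be a probability mass function on $\mathcal X^n$ (the $Q_n$ need not be consistent with one another), with law denoted by $Q_{X^n}$, and suppose that for every $P\in\mathcal P_s$ $$\frac1n\, I(P_{X^n}|Q_{X^n})\to 0\qquad\text{or}\qquad \frac1n\log\frac{P(X^n)}{Q(X^n)}\to 0\ \text{ in } L^1(P)\qquad (n\to\infty).$$ For $0\le t<n$ let $Q_n(x_t|x_0,\dots,x_{t-1})$ be the conditional probability mass functions in the chain rule expansion $Q_n(x^n)=\prod_{0\le t<n}Q_n(x_t|x_0,\dots,x_{t-1})$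 (any probability mass function where the conditioning string has $Q_n$-probability zero), let $Q_n(x|X^{-t})$ be the value at $x_t=x$, $(x_0,\dots,x_{t-1})=(X_{-t},\dots,X_{-1})$, and define $$\hat P(x|X^{-n})=\frac1n\sum_{0\le t<n}Q_n(x|X^{-t}).$$ Then the estimates $\hat P(x|X^{-n})$ are consistent in expected information divergence for $\mathcal P_s$: for every $P\in\mathcal P_s$, $$E_P\{I(P_{X|X^-}|\hat P_{X|X^{-n}})\}\to 0\qquad (n\to\infty),$$ where $P_{X|X^-}$ is the conditional distribution of $X_0$ given the infinite past $X^-$. -/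

import Mathlib

open MeasureTheory ProbabilityTheory InformationTheory Filter Topology
open scoped ENNReal

namespace FiniteAlphabet

/-- The left shift on two-sided sequences. -/
def shift {α : Type*} (ω : ℤ → α) : ℤ → α := fun t => ω (t + 1)

/-- The block `X^n = (X_0, …, X_{n-1})`. -/
def block {α : Type*} (n : ℕ) (ω : ℤ → α) : Fin n → α := fun i => ω (i : ℤ)

/-- The `n`-past `X^{-n} = (X_{-n}, …, X_{-1})` at time `0`, in chronological order. -/
def past {α : Type*} (n : ℕ) (ω : ℤ → α) : Fin n → α := fun i => ω (-(n : ℤ) + (i : ℤ))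

/-- The infinite past `X^- = (…, X_{-2}, X_{-1})` at time `0`; entry `k` is `X_{-(k+1)}`. -/
def infinitePast {α : Type*} (ω : ℤ → α) : ℕ → α := fun k => ω (-((k : ℤ) + 1))

/-- The class of all stationary process distributions on two-sided sequences. -/
def stationaryLaws (α : Type*) [MeasurableSpace α] : Set (ProbabilityMeasure (ℤ → α)) :=
  {P | MeasurePreserving shift (P : Measure (ℤ → α)) (P : Measure (ℤ → α))}

/-- The law of the block `X^n` under `P`. -/
noncomputable def blockLaw {α : Type*} [MeasurableSpace α] (P : ProbabilityMeasure (ℤ → α))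
    (n : ℕ) : Measure (Fin n → α) :=
  (P : Measure (ℤ → α)).map (block n)

/-- The per-symbol divergence `n⁻¹ I(P_{X^n} | Q_{X^n})` tends to `0`. -/
def PerSymbolDivergenceVanishes {α : Type*} [MeasurableSpace α]
    (Q : ∀ n : ℕ, PMF (Fin n → α)) (P : ProbabilityMeasure (ℤ → α)) : Prop :=
  Tendsto (fun n : ℕ => (n : ℝ≥0∞)⁻¹ * klDiv (blockLaw P n) (Q n).toMeasure) atTop (𝓝 0)

/-- `n⁻¹ log (P(X^n) / Q(X^n))` tends to `0` in `L¹(P)`. The logarithm takes values in the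
extended reals, so that the mean is infinite if `Q(X^n)` vanishes with positive probability. -/
def PerSymbolLogRatioVanishes {α : Type*} [MeasurableSpace α]
    (Q : ∀ n : ℕ, PMF (Fin n → α)) (P : ProbabilityMeasure (ℤ → α)) : Prop :=
  Tendsto (fun n : ℕ => ∫⁻ ω, (n : ℝ≥0∞)⁻¹ *
      (ENNReal.log (blockLaw P n {block n ω} / Q n (block n ω))).abs ∂(P : Measure (ℤ → α)))
    atTop (𝓝 0)

/-- The conditional distribution `Q(x_t | x^t)` of the coordinate `x_t` given the preceding
coordinates `x^t = (x_0, …, x_{t-1})`, under a probability mass function `Q(x^n)` with `t < n`.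
At a prefix of positive `Q`-probability it is the quotient of the marginals `Q(x^{t+1}) / Q(x^t)`;
at any other prefix it is some probability distribution. -/
noncomputable def conditional {α : Type*} [Finite α] [Nonempty α] [MeasurableSpace α]
    [DiscreteMeasurableSpace α] {n : ℕ} (Q : PMF (Fin n → α)) (t : Fin n) :
    Kernel (Fin (t : ℕ) → α) α :=
  condDistrib (fun y : Fin n → α => y t)
    (fun (y : Fin n → α) (i : Fin (t : ℕ)) => y (Fin.castLE t.isLt.le i)) Q.toMeasure

/-- The last `t` entries of a string of length `n`. -/
def suffix {α : Type*} {n : ℕ} (t : Fin n) (a : Fin n → α) : Fin (t : ℕ) → α :=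
  fun i => a ⟨n - (t : ℕ) + (i : ℕ), by omega⟩

/-- The estimate `n⁻¹ ∑_{t < n} Q(· | X^{-t})` as a function of the `n`-past, where
`Q(· | x^t)` is the conditional distribution of `x_t` in the chain rule expansion of `Q(x^n)`. -/
noncomputable def cesaroEstimate {α : Type*} [Finite α] [Nonempty α] [MeasurableSpace α]
    [DiscreteMeasurableSpace α] (Q : ∀ n : ℕ, PMF (Fin n → α)) (n : ℕ) (a : Fin n → α) :
    Measure α :=
  (n : ℝ≥0∞)⁻¹ • ∑ t : Fin n, conditional (Q n) t (suffix t a)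

/-- The estimates `est n`, functions of the `n`-past, are consistent in expected information
divergence for the class `C`: for each `P` in `C`, the expected divergence of the conditional
distribution of `X_0` given the infinite past relative to the estimate tends to `0`. -/
def ConsistentInExpectedDivergence {α : Type*} [Finite α] [Nonempty α] [MeasurableSpace α]
    [DiscreteMeasurableSpace α] (est : ∀ n : ℕ, (Fin n → α) → Measure α)
    (C : Set (ProbabilityMeasure (ℤ → α))) : Prop :=
  ∀ P ∈ C, Tendsto
    (fun n : ℕ => ∫⁻ ω,
      klDiv (condDistrib (fun ω : ℤ → α => ω 0) infinitePast (P : Measure (ℤ → α))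
          (infinitePast ω))
        (est n (past n ω)) ∂(P : Measure (ℤ → α)))
    atTop (𝓝 0)

end FiniteAlphabet

/-! Everything is written as cross-entropies in `ℝ≥0∞`, where divergence plus entropy equals
cross-entropy (`klDiv_add_entropy`). Hence the expected divergence of the estimate, plus the entropy
rate H(X_0 | X^-), is the mean self-information of X_0 under the estimate
(`lintegral_klDiv_add_entropyRate`). Convexity of -log bounds this by the average over t < n of the
mean self-information of X_0 under Q_n(· | X^{-t}). Stationarity moves the t-th term to time t, and
the chain rule collapses the average to n⁻¹ times the cross-entropy of P_{X^n} and Q_n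
(`crossEntropy_blockLaw`). Either hypothesis bounds that by n⁻¹ H(X^n) + o(1), which tends to the
entropy rate by Lévy's upward theorem and Cesàro averaging (`tendsto_entropy_blockLaw`). The entropy
rate is finite, so it can be subtracted. -/

namespace FiniteAlphabet

/-! ### Self-information, cross-entropy and divergence on finite sets. -/

section Information

/-- The self-information `-log y` of an event of probability `y ≤ 1`, infinite at `y = 0`. -/
noncomputable def selfInfo (y : ℝ≥0∞) : ℝ≥0∞ :=
  if y = 0 then ⊤ else ENNReal.ofReal (-Real.log y.toReal)

lemma selfInfo_zero : selfInfo 0 = ⊤ := by simp [selfInfo]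

lemma selfInfo_of_ne_zero {y : ℝ≥0∞} (hy : y ≠ 0) :
    selfInfo y = ENNReal.ofReal (-Real.log y.toReal) := by simp [selfInfo, hy]

lemma selfInfo_one : selfInfo 1 = 0 := by simp [selfInfo]

lemma measurable_selfInfo : Measurable selfInfo :=
  Measurable.ite (measurableSet_singleton 0) measurable_const (by fun_prop)

lemma log_toReal_nonpos {y : ℝ≥0∞} (hy : y ≤ 1) : Real.log y.toReal ≤ 0 :=
  Real.log_nonpos ENNReal.toReal_nonneg (ENNReal.toReal_le_of_le_ofReal zero_le_one (by simpa))

lemma selfInfo_mul {a b : ℝ≥0∞} (ha : a ≤ 1) (hb : b ≤ 1) :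
    selfInfo (a * b) = selfInfo a + selfInfo b := by
  rcases eq_or_ne a 0 with rfl | ha0
  · simp [selfInfo_zero]
  rcases eq_or_ne b 0 with rfl | hb0
  · simp [selfInfo_zero]
  have hat : a ≠ ⊤ := ne_top_of_le_ne_top ENNReal.one_ne_top ha
  have hbt : b ≠ ⊤ := ne_top_of_le_ne_top ENNReal.one_ne_top hb
  rw [selfInfo_of_ne_zero ha0, selfInfo_of_ne_zero hb0, selfInfo_of_ne_zero (mul_ne_zero ha0 hb0),
    ← ENNReal.ofReal_add (neg_nonneg.2 (log_toReal_nonpos ha))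
      (neg_nonneg.2 (log_toReal_nonpos hb)), ENNReal.toReal_mul,
    Real.log_mul (ENNReal.toReal_ne_zero.2 ⟨ha0, hat⟩) (ENNReal.toReal_ne_zero.2 ⟨hb0, hbt⟩)]
  congr 1
  ring

lemma mul_selfInfo {x : ℝ≥0∞} (hx : x ≤ 1) :
    x * selfInfo x = ENNReal.ofReal (Real.negMulLog x.toReal) := by
  rcases eq_or_ne x 0 with rfl | hx0
  · simp
  rw [selfInfo_of_ne_zero hx0]
  nth_rewrite 1 [← ENNReal.ofReal_toReal (ne_top_of_le_ne_top ENNReal.one_ne_top hx)]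
  rw [← ENNReal.ofReal_mul ENNReal.toReal_nonneg, Real.negMulLog]
  congr 1
  ring

/-- Convexity of the self-information, for uniform weights. -/
lemma selfInfo_average_le {n : ℕ} (hn : n ≠ 0) (y : Fin n → ℝ≥0∞) (hy : ∀ t, y t ≤ 1) :
    selfInfo ((n : ℝ≥0∞)⁻¹ * ∑ t, y t) ≤ (n : ℝ≥0∞)⁻¹ * ∑ t, selfInfo (y t) := by
  have hn' : (n : ℝ) ≠ 0 := Nat.cast_ne_zero.2 hn
  have hyt : ∀ t, y t ≠ ⊤ := fun t => ne_top_of_le_ne_top ENNReal.one_ne_top (hy t)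
  -- One vanishing `y t` makes the right side infinite; otherwise Jensen applies to log on the open
  -- half-line.
  by_cases h0 : ∃ t, y t = 0
  · obtain ⟨t, ht⟩ := h0
    have : ∑ t, selfInfo (y t) = ⊤ :=
      ENNReal.sum_eq_top.2 ⟨t, Finset.mem_univ _, by rw [ht, selfInfo_zero]⟩
    rw [this, ENNReal.mul_top (by simp)]
    exact le_top
  push Not at h0
  have : Nonempty (Fin n) := ⟨⟨0, Nat.pos_of_ne_zero hn⟩⟩
  have hpos : (n : ℝ≥0∞)⁻¹ * ∑ t, y t ≠ 0 := by
    refine mul_ne_zero (by simp) fun h => ?_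
    exact h0 (Classical.arbitrary _) (Finset.sum_eq_zero_iff.1 h _ (Finset.mem_univ _))
  rw [selfInfo_of_ne_zero hpos]
  simp_rw [selfInfo_of_ne_zero (h0 _)]
  rw [← ENNReal.ofReal_sum_of_nonneg fun t _ => neg_nonneg.2 (log_toReal_nonpos (hy t))]
  have hninv : (n : ℝ≥0∞)⁻¹ = ENNReal.ofReal ((n : ℝ)⁻¹) := by
    rw [ENNReal.ofReal_inv_of_pos (by positivity), ENNReal.ofReal_natCast]
  rw [hninv, ← ENNReal.ofReal_mul (by positivity)]
  apply ENNReal.ofReal_le_ofReal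
  have key := strictConcaveOn_log_Ioi.concaveOn.le_map_sum (t := Finset.univ)
    (w := fun _ : Fin n => (n : ℝ)⁻¹) (p := fun t => (y t).toReal) (fun _ _ => by positivity)
    (by simp [hn']) (fun t _ => ENNReal.toReal_pos (h0 t) (hyt t))
  simp only [smul_eq_mul, ← Finset.mul_sum] at key
  rw [ENNReal.toReal_mul, ENNReal.toReal_ofReal (by positivity),
    ENNReal.toReal_sum fun t _ => hyt t, Finset.sum_neg_distrib]
  linarith

/-- The cross-entropy `-E_μ log ν(X)`. -/
noncomputable def crossEntropy {β : Type*} [MeasurableSpace β] (μ ν : Measure β) : ℝ≥0∞ :=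
  ∫⁻ x, selfInfo (ν {x}) ∂μ

variable {β : Type*} [MeasurableSpace β] [DiscreteMeasurableSpace β]

lemma crossEntropy_eq_sum [Fintype β] (μ ν : Measure β) :
    crossEntropy μ ν = ∑ x, selfInfo (ν {x}) * μ {x} :=
  lintegral_fintype _

lemma entropy_eq_sum [Fintype β] (μ : Measure β) [IsProbabilityMeasure μ] :
    crossEntropy μ μ = ∑ x, ENNReal.ofReal (Real.negMulLog (μ.real {x})) := by
  rw [crossEntropy_eq_sum]
  refine Finset.sum_congr rfl fun x _ => ?_
  rw [mul_comm, mul_selfInfo prob_le_one, Measure.real]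

/-- Crude, from -x log x ≤ 1 - x; it serves only for finiteness and as a dominating constant. -/
lemma entropy_le_card [Fintype β] (μ : Measure β) [IsProbabilityMeasure μ] :
    crossEntropy μ μ ≤ Fintype.card β := by
  rw [entropy_eq_sum]
  calc _ ≤ ∑ _x : β, (1 : ℝ≥0∞) := Finset.sum_le_sum fun x _ => by
        rw [← ENNReal.ofReal_one]
        apply ENNReal.ofReal_le_ofReal
        have := Real.negMulLog_le_one_sub_self (x := μ.real {x}) measureReal_nonneg
        have := measureReal_nonneg (μ := μ) (s := {x})
        linarith
    _ = _ := by simp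

lemma neg_log_measureReal_mul_nonneg {β : Type*} [MeasurableSpace β] (μ ν : Measure β)
    [IsProbabilityMeasure ν] (x : β) : 0 ≤ -Real.log (ν.real {x}) * μ.real {x} :=
  mul_nonneg (neg_nonneg.2 (log_toReal_nonpos prob_le_one)) measureReal_nonneg

lemma crossEntropy_eq_ofReal [Fintype β] {μ ν : Measure β} [IsProbabilityMeasure μ]
    [IsProbabilityMeasure ν] (h : μ ≪ ν) :
    crossEntropy μ ν = ENNReal.ofReal (∑ x, -Real.log (ν.real {x}) * μ.real {x}) := by
  rw [crossEntropy_eq_sum, ENNReal.ofReal_sum_of_nonneg fun x _ =>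
    neg_log_measureReal_mul_nonneg μ ν x]
  refine Finset.sum_congr rfl fun x _ => ?_
  by_cases hx : ν {x} = 0
  · simp [h hx, Measure.real]
  · rw [selfInfo_of_ne_zero hx,
      Measure.real, Measure.real, ENNReal.ofReal_mul (neg_nonneg.2 (log_toReal_nonpos prob_le_one)),
      ENNReal.ofReal_toReal (measure_ne_top μ _)]

/-- Divergence plus entropy is cross-entropy. -/
lemma klDiv_add_entropy [Finite β] (μ ν : Measure β) [IsProbabilityMeasure μ]
    [IsProbabilityMeasure ν] :
    klDiv μ ν + crossEntropy μ μ = crossEntropy μ ν := by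
  have := Fintype.ofFinite β
  by_cases h : μ ≪ ν
  · have hint : Integrable (llr μ ν) μ := Integrable.of_finite
    have hkl := toReal_klDiv_of_measure_eq h (by simp)
    have hnn : 0 ≤ ∫ a, llr μ ν a ∂μ := hkl ▸ ENNReal.toReal_nonneg
    rw [← ENNReal.ofReal_toReal (klDiv_ne_top h hint), hkl, crossEntropy_eq_ofReal h,
      crossEntropy_eq_ofReal Measure.AbsolutelyContinuous.rfl,
      ← ENNReal.ofReal_add hnn (Finset.sum_nonneg fun x _ =>
        neg_log_measureReal_mul_nonneg μ μ x),
      integral_fintype hint, ← Finset.sum_add_distrib]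
    congr 1
    refine Finset.sum_congr rfl fun x _ => ?_
    by_cases hx : μ {x} = 0
    · simp [Measure.real, hx]
    have hνx : ν {x} ≠ 0 := fun h0 => hx (h h0)
    -- At an atom the density is the quotient of the point masses, so `llr` splits into two
    -- logarithms.
    have hrn : (μ.rnDeriv ν x).toReal * ν.real {x} = μ.real {x} := by
      rw [Measure.real, Measure.real, ← ENNReal.toReal_mul, ← lintegral_singleton,
        Measure.setLIntegral_rnDeriv h]
    have h1 : μ.real {x} ≠ 0 := (measureReal_ne_zero_iff).2 hx
    have h2 : ν.real {x} ≠ 0 := (measureReal_ne_zero_iff).2 hνx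
    have h3 : (μ.rnDeriv ν x).toReal ≠ 0 := fun h0 => h1 (by rw [← hrn, h0, zero_mul])
    rw [llr, ← hrn, Real.log_mul h3 h2, smul_eq_mul]
    ring
  -- Some point has ν-mass zero and positive μ-mass, so the cross-entropy is infinite too.
  · rw [klDiv_of_not_ac h, top_add, crossEntropy_eq_sum]
    obtain ⟨x, hν, hμ⟩ : ∃ x, ν {x} = 0 ∧ μ {x} ≠ 0 := by
      by_contra! hcon
      refine h fun s hs => ?_
      rw [← Set.biUnion_of_singleton s]
      exact (measure_biUnion_null_iff s.to_countable).2 fun x hx =>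
        hcon x (measure_mono_null (Set.singleton_subset_iff.2 hx) hs)
    refine (ENNReal.sum_eq_top.2 ⟨x, Finset.mem_univ _, ?_⟩).symm
    rw [hν, selfInfo_zero, ENNReal.top_mul hμ]

lemma selfInfo_le_abs_log_div_add {p q : ℝ≥0∞} (hp : p ≠ 0) (hp1 : p ≤ 1) (hq1 : q ≤ 1) :
    selfInfo q ≤ (ENNReal.log (p / q)).abs + selfInfo p := by
  have hpt : p ≠ ⊤ := ne_top_of_le_ne_top ENNReal.one_ne_top hp1
  have hqt : q ≠ ⊤ := ne_top_of_le_ne_top ENNReal.one_ne_top hq1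
  rcases eq_or_ne q 0 with rfl | hq
  · simp [ENNReal.div_zero hp]
  rw [ENNReal.log_pos_real (ENNReal.div_ne_zero.2 ⟨hp, hqt⟩) (ENNReal.div_ne_top hpt hq),
    EReal.abs_def, selfInfo_of_ne_zero hp, selfInfo_of_ne_zero hq,
    ← ENNReal.ofReal_add (abs_nonneg _) (neg_nonneg.2 (log_toReal_nonpos hp1)), ENNReal.toReal_div,
    Real.log_div (ENNReal.toReal_ne_zero.2 ⟨hp, hpt⟩) (ENNReal.toReal_ne_zero.2 ⟨hq, hqt⟩)]
  apply ENNReal.ofReal_le_ofReal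
  linarith [le_abs_self (Real.log p.toReal - Real.log q.toReal)]

lemma crossEntropy_le_lintegral_abs_log_add [Finite β] (μ ν : Measure β) [IsProbabilityMeasure μ]
    [IsProbabilityMeasure ν] :
    crossEntropy μ ν ≤ (∫⁻ x, (ENNReal.log (μ {x} / ν {x})).abs ∂μ) + crossEntropy μ μ := by
  have := Fintype.ofFinite β
  rw [crossEntropy, crossEntropy, ← lintegral_add_left (.of_discrete), lintegral_fintype,
    lintegral_fintype]
  refine Finset.sum_le_sum fun x _ => ?_
  by_cases hx : μ {x} = 0
  · simp [hx]
  · gcongr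
    exact selfInfo_le_abs_log_div_add hx prob_le_one prob_le_one

end Information

/-! ### Chain rule for the self-information of a string. -/

section ChainRule

lemma lintegral_condDistrib {Ω β γ : Type*} [MeasurableSpace Ω] [MeasurableSpace β]
    [MeasurableSpace γ] [StandardBorelSpace γ] [Nonempty γ] (P : Measure Ω) [IsFiniteMeasure P]
    {X : Ω → β} {Y : Ω → γ} (hX : Measurable X) (hY : Measurable Y) {f : β × γ → ℝ≥0∞}
    (hf : Measurable f) :
    ∫⁻ ω, ∫⁻ y, f (X ω, y) ∂(condDistrib Y X P (X ω)) ∂P = ∫⁻ ω, f (X ω, Y ω) ∂P := by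
  rw [← lintegral_map hf (hX.prodMk hY), ← compProd_map_condDistrib hY.aemeasurable,
    Measure.lintegral_compProd hf, lintegral_map _ hX]
  exact hf.lintegral_kernel_prod_right'

variable {α : Type*} [Finite α] [Nonempty α] [MeasurableSpace α] [DiscreteMeasurableSpace α]

/-- The prefix of length `m` of a string of length `n ≥ m`. -/
def initial {α : Type*} {m n : ℕ} (h : m ≤ n) (y : Fin n → α) : Fin m → α :=
  fun i => y (Fin.castLE h i)

lemma map_initial_succ {n m : ℕ} (Q : PMF (Fin n → α)) (h : m < n) (x : Fin n → α) :
    Q.toMeasure.map (initial (Nat.succ_le_of_lt h)) {initial (Nat.succ_le_of_lt h) x} =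
      Q.toMeasure.map (initial h.le) {initial h.le x} *
        conditional Q ⟨m, h⟩ (initial h.le x) {x ⟨m, h⟩} := by
  have key := compProd_map_condDistrib (X := initial (α := α) h.le) (μ := Q.toMeasure)
    (mβ := MeasurableSpace.pi)
    (Y := fun y : Fin n → α => y ⟨m, h⟩) Measurable.of_discrete.aemeasurable
  have h1 : Q.toMeasure.map (initial (Nat.succ_le_of_lt h)) {initial (Nat.succ_le_of_lt h) x} =
      Q.toMeasure.map (fun y => (initial h.le y, y ⟨m, h⟩)) ({initial h.le x} ×ˢ {x ⟨m, h⟩}) := by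
    rw [Measure.map_apply .of_discrete .of_discrete, Measure.map_apply .of_discrete .of_discrete]
    congr 1
    ext y
    simp only [Set.mem_preimage, Set.mem_singleton_iff, Set.mem_prod]
    constructor
    · intro hy
      exact ⟨funext fun i => congrFun hy i.castSucc, congrFun hy (Fin.last m)⟩
    · rintro ⟨hy, hym⟩
      funext i
      induction i using Fin.lastCases with
      | last => exact hym
      | cast i => exact congrFun hy i
  rw [h1, ← key, Measure.compProd_apply_prod .of_discrete .of_discrete, lintegral_singleton,
    mul_comm]
  rfl

instance isMarkovKernel_conditional {n : ℕ} (Q : PMF (Fin n → α)) (t : Fin n) : IsMarkovKernel (conditional Q t) := by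
  unfold conditional
  infer_instance

/-- Null prefixes need no separate treatment: the product formula holds there as 0 = 0, and
`selfInfo 0 = ⊤` absorbs the arbitrary conditionals. -/
lemma selfInfo_map_initial {n : ℕ} (Q : PMF (Fin n → α)) (x : Fin n → α) (m : ℕ) (h : m ≤ n) :
    selfInfo (Q.toMeasure.map (initial h) {initial h x}) =
      ∑ i : Fin m, selfInfo (conditional Q (Fin.castLE h i)
        (initial (Fin.castLE h i).isLt.le x) {x (Fin.castLE h i)}) := by
  have : ∀ m (h : m ≤ n), IsProbabilityMeasure (Q.toMeasure.map (initial (α := α) h)) := fun m h =>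
    Measure.isProbabilityMeasure_map Measurable.of_discrete.aemeasurable
  induction m with
  | zero =>
    have : ({initial h x} : Set (Fin 0 → α)) = Set.univ := by
      ext y; simp [eq_iff_true_of_subsingleton]
    simp [this, selfInfo_one]
  | succ m ih =>
    have : IsProbabilityMeasure (conditional Q ⟨m, h⟩ (initial (Nat.le_of_succ_le h) x)) :=
      (isMarkovKernel_conditional Q ⟨m, h⟩).isProbabilityMeasure _
    rw [map_initial_succ Q h x, selfInfo_mul prob_le_one prob_le_one,
      ih (Nat.le_of_succ_le h), Fin.sum_univ_castSucc]
    rfl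

/-- The chain rule for the self-information of a string. -/
lemma selfInfo_eq_sum_conditional {n : ℕ} (Q : PMF (Fin n → α)) (x : Fin n → α) :
    selfInfo (Q.toMeasure {x}) =
      ∑ t : Fin n, selfInfo (conditional Q t (initial t.isLt.le x) {x t}) := by
  have := selfInfo_map_initial Q x n le_rfl
  have hid : initial (α := α) (le_refl n) = id := rfl
  rw [hid, Measure.map_id] at this
  exact this

end ChainRule

/-! ### Stationarity and block entropies. -/

section Stationary

variable {α : Type*} [MeasurableSpace α]

lemma measurable_block (n : ℕ) : Measurable (block (α := α) n) := by
  unfold block; fun_prop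

lemma measurable_past (n : ℕ) : Measurable (past (α := α) n) := by
  unfold past; fun_prop

lemma measurable_infinitePast : Measurable (infinitePast (α := α)) := by
  unfold infinitePast; fun_prop

lemma iterate_shift {α : Type*} (n : ℕ) (ω : ℤ → α) (t : ℤ) : shift^[n] ω t = ω (t + n) := by
  induction n generalizing ω with
  | zero => simp
  | succ n ih => rw [Function.iterate_succ_apply, ih, shift]; push_cast; ring_nf

/-- Under a stationary law, `(X^t, X_t)` and `(X^{-t}, X_0)` are identically distributed. -/
lemma map_block_eq_map_past {P : ProbabilityMeasure (ℤ → α)} (hP : P ∈ stationaryLaws α) (t : ℕ) :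
    (P : Measure (ℤ → α)).map (fun ω => (block t ω, ω t)) =
      (P : Measure (ℤ → α)).map (fun ω => (past t ω, ω 0)) := by
  have hmp := MeasurePreserving.iterate (show MeasurePreserving shift _ _ from hP) t
  have hm : Measurable fun ω : ℤ → α => (past t ω, ω 0) :=
    (measurable_past t).prodMk (measurable_pi_apply 0)
  -- Composing with the `t`-fold shift turns (X^{-t}, X_0) into (X^t, X_t).
  conv_rhs => rw [← hmp.map_eq, Measure.map_map hm hmp.measurable]
  congr 1
  funext ω
  simp only [Function.comp_apply, Prod.mk.injEq, iterate_shift, zero_add, and_true]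
  funext i
  simp only [block, past, iterate_shift]
  congr 1
  ring

instance (P : ProbabilityMeasure (ℤ → α)) (n : ℕ) : IsProbabilityMeasure (blockLaw P n) :=
  Measure.isProbabilityMeasure_map (measurable_block n).aemeasurable

lemma suffix_past {α : Type*} {n : ℕ} (t : Fin n) (ω : ℤ → α) : suffix t (past n ω) = past t ω := by
  funext i
  simp only [suffix, past]
  congr 1
  have := t.isLt
  push_cast [Nat.cast_sub t.isLt.le]
  ring

variable [Finite α] [Nonempty α] [DiscreteMeasurableSpace α]

/-- The chain rule for cross-entropy, with every term moved to time `0` by stationarity. -/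
lemma crossEntropy_blockLaw {P : ProbabilityMeasure (ℤ → α)} (hP : P ∈ stationaryLaws α) {n : ℕ}
    (Q : PMF (Fin n → α)) :
    crossEntropy (blockLaw P n) Q.toMeasure =
      ∑ t : Fin n, ∫⁻ ω, selfInfo (conditional Q t (past t ω) {ω 0}) ∂(P : Measure (ℤ → α)) := by
  rw [crossEntropy, blockLaw, lintegral_map .of_discrete (measurable_block n)]
  simp_rw [selfInfo_eq_sum_conditional Q]
  rw [lintegral_finsetSum]
  · refine Finset.sum_congr rfl fun t _ => ?_
    have hf : Measurable fun z : (Fin (t : ℕ) → α) × α => selfInfo (conditional Q t z.1 {z.2}) :=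
      .of_discrete
    have h1 := lintegral_map (μ := (P : Measure (ℤ → α))) hf
      ((measurable_block t).prodMk (measurable_pi_apply (t : ℤ)))
    have h2 := lintegral_map (μ := (P : Measure (ℤ → α))) hf
      ((measurable_past t).prodMk (measurable_pi_apply (0 : ℤ)))
    rw [map_block_eq_map_past hP] at h1
    exact h1.symm.trans h2
  · intro t _
    exact (Measurable.of_discrete (f := fun x : Fin n → α =>
      selfInfo (conditional Q t (initial t.isLt.le x) {x t}))).comp (measurable_block n)

/-- The conditional entropy `H(X_0 | X^{-t})`. -/
noncomputable def finiteEntropy (P : ProbabilityMeasure (ℤ → α)) (t : ℕ) : ℝ≥0∞ :=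
  ∫⁻ ω, crossEntropy (condDistrib (fun ω : ℤ → α => ω 0) (past t) P (past t ω))
    (condDistrib (fun ω : ℤ → α => ω 0) (past t) P (past t ω)) ∂(P : Measure (ℤ → α))

/-- The conditional entropy `H(X_0 | X^-)`. -/
noncomputable def entropyRate (P : ProbabilityMeasure (ℤ → α)) : ℝ≥0∞ :=
  ∫⁻ ω, crossEntropy (condDistrib (fun ω : ℤ → α => ω 0) infinitePast P (infinitePast ω))
    (condDistrib (fun ω : ℤ → α => ω 0) infinitePast P (infinitePast ω)) ∂(P : Measure (ℤ → α))

/-- `condDistrib` depends only on the joint law of the pair, so the kernels agree everywhere, null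
prefixes included. -/
lemma conditional_blockLaw {P : ProbabilityMeasure (ℤ → α)} (hP : P ∈ stationaryLaws α) {n : ℕ}
    (t : Fin n) :
    conditional (blockLaw P n).toPMF t =
      condDistrib (fun ω : ℤ → α => ω 0) (past t) (P : Measure (ℤ → α)) := by
  unfold conditional
  simp only [condDistrib_def]
  congr 1
  rw [Measure.toPMF_toMeasure, ← map_block_eq_map_past hP, blockLaw,
    Measure.map_map .of_discrete (measurable_block n)]
  rfl

/-- The chain rule for the entropy of a stationary block. -/
lemma entropy_blockLaw {P : ProbabilityMeasure (ℤ → α)} (hP : P ∈ stationaryLaws α) (n : ℕ) :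
    crossEntropy (blockLaw P n) (blockLaw P n) = ∑ t ∈ Finset.range n, finiteEntropy P t := by
  have := crossEntropy_blockLaw hP (blockLaw P n).toPMF
  rw [Measure.toPMF_toMeasure] at this
  rw [this, ← Fin.sum_univ_eq_sum_range]
  refine Finset.sum_congr rfl fun t _ => ?_
  rw [conditional_blockLaw hP, finiteEntropy]
  exact (lintegral_condDistrib (P : Measure (ℤ → α)) (measurable_past t)
    (measurable_pi_apply (0 : ℤ)) (f := fun z : (Fin (t : ℕ) → α) × α =>
      selfInfo (condDistrib (fun ω : ℤ → α => ω 0) (past t) (P : Measure (ℤ → α)) z.1 {z.2}))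
      .of_discrete).symm

end Stationary

/-! ### Convergence of the entropy per symbol to the entropy rate. -/

section EntropyRate

variable {α : Type*} [MeasurableSpace α]

/-- The filtration generated by the finite pasts. -/
def pastFiltration (α : Type*) [MeasurableSpace α] :
    Filtration ℕ (inferInstance : MeasurableSpace (ℤ → α)) where
  seq n := MeasurableSpace.comap (past n) inferInstance
  mono' := by
    refine monotone_nat_of_le_succ fun n => ?_
    have h : past (α := α) n = (fun a (i : Fin n) => a i.succ) ∘ past (n + 1) := by
      funext ω i
      simp only [past, Function.comp_apply]
      congr 1
      push_cast [Fin.val_succ]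
      ring
    rw [h, ← MeasurableSpace.comap_comp]
    exact MeasurableSpace.comap_mono (Measurable.comap_le (by fun_prop))
  le' n := (measurable_past n).comap_le

lemma iSup_pastFiltration :
    ⨆ n, (pastFiltration α n) = MeasurableSpace.comap (infinitePast (α := α)) inferInstance := by
  apply le_antisymm
  · refine iSup_le fun n => ?_
    have h : past (α := α) n = (fun a (i : Fin n) => a (n - 1 - i)) ∘ infinitePast := by
      funext ω i
      simp only [past, Function.comp_apply, infinitePast]
      congr 1
      omega
    change MeasurableSpace.comap (past n) inferInstance ≤ _
    rw [h, ← MeasurableSpace.comap_comp]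
    exact MeasurableSpace.comap_mono (Measurable.comap_le (by fun_prop))
  · change MeasurableSpace.comap infinitePast MeasurableSpace.pi ≤ _
    rw [MeasurableSpace.pi, MeasurableSpace.comap_iSup]
    refine iSup_le fun k => ?_
    -- Entry `k` is X_{-(k+1)}, the oldest symbol of the past of length `k + 1`.
    have h : (fun a : ℕ → α => a k) ∘ infinitePast =
        (fun a : Fin (k + 1) → α => a 0) ∘ past (k + 1) := by
      funext ω
      simp [past, infinitePast]
    rw [MeasurableSpace.comap_comp, h, ← MeasurableSpace.comap_comp]
    refine (MeasurableSpace.comap_mono (measurable_pi_apply 0).comap_le).trans ?_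
    exact le_iSup (fun n => (pastFiltration α n : MeasurableSpace (ℤ → α))) (k + 1)

lemma measurable_entropy_kernel {β : Type*} [MeasurableSpace β] [Finite α] [DiscreteMeasurableSpace α]
    (κ : Kernel β α) [IsMarkovKernel κ] : Measurable fun b => crossEntropy (κ b) (κ b) := by
  have := Fintype.ofFinite α
  simp_rw [crossEntropy_eq_sum]
  exact Finset.measurable_fun_sum _ fun x _ =>
    (measurable_selfInfo.comp (κ.measurable_coe .of_discrete)).mul (κ.measurable_coe .of_discrete)

lemma tendsto_cesaro_ennreal {u : ℕ → ℝ≥0∞} {l : ℝ≥0∞} (hu : ∀ n, u n ≠ ⊤) (hl : l ≠ ⊤)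
    (h : Tendsto u atTop (𝓝 l)) :
    Tendsto (fun n : ℕ => (n : ℝ≥0∞)⁻¹ * ∑ i ∈ Finset.range n, u i) atTop (𝓝 l) := by
  have h1 : Tendsto (fun n : ℕ => ENNReal.ofReal ((n : ℝ)⁻¹ *
      ∑ i ∈ Finset.range n, (u i).toReal)) atTop (𝓝 (ENNReal.ofReal l.toReal)) := ENNReal.tendsto_ofReal (((ENNReal.tendsto_toReal hl).comp h).cesaro)
  rw [ENNReal.ofReal_toReal hl] at h1
  refine h1.congr' ?_
  filter_upwards [eventually_gt_atTop 0] with n hn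
  have hn' : (0 : ℝ) < n := Nat.cast_pos.2 hn
  rw [ENNReal.ofReal_mul (by positivity), ENNReal.ofReal_inv_of_pos hn', ENNReal.ofReal_natCast,
    ENNReal.ofReal_sum_of_nonneg fun i _ => ENNReal.toReal_nonneg]
  simp [ENNReal.ofReal_toReal (hu _)]

variable [Finite α] [Nonempty α] [DiscreteMeasurableSpace α]

/-- Lévy's upward theorem for the conditional probabilities given the past. -/
lemma tendsto_condDistrib_past (P : ProbabilityMeasure (ℤ → α)) (x : α) :
    ∀ᵐ ω ∂(P : Measure (ℤ → α)), Tendsto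
      (fun t => (condDistrib (fun ω : ℤ → α => ω 0) (past t) P (past t ω)).real {x}) atTop
      (𝓝 ((condDistrib (fun ω : ℤ → α => ω 0) infinitePast P (infinitePast ω)).real {x})) := by
  have hx : MeasurableSet ({x} : Set α) := .of_discrete
  have hfin : ∀ t, _ := fun t => condDistrib_ae_eq_condExp (μ := (P : Measure (ℤ → α)))
    (measurable_past (α := α) t) (measurable_pi_apply (0 : ℤ)) hx
  have hinf := condDistrib_ae_eq_condExp (μ := (P : Measure (ℤ → α)))
    (measurable_infinitePast (α := α)) (measurable_pi_apply (0 : ℤ)) hx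
  rw [← iSup_pastFiltration] at hinf
  filter_upwards [ae_all_iff.2 hfin, hinf, tendsto_ae_condExp (μ := (P : Measure (ℤ → α)))
    (ℱ := pastFiltration α) (((fun ω : ℤ → α => ω 0) ⁻¹' {x}).indicator fun _ => (1 : ℝ))]
    with ω h1 h2 h3
  rw [h2]
  exact h3.congr fun t => (h1 t).symm

lemma finiteEntropy_ne_top (P : ProbabilityMeasure (ℤ → α)) (t : ℕ) : finiteEntropy P t ≠ ⊤ := by
  have := Fintype.ofFinite α
  refine ne_top_of_le_ne_top (ENNReal.natCast_ne_top (Fintype.card α)) ?_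
  exact (lintegral_mono fun ω => entropy_le_card _).trans (by simp)

lemma entropyRate_ne_top (P : ProbabilityMeasure (ℤ → α)) : entropyRate P ≠ ⊤ := by
  have := Fintype.ofFinite α
  refine ne_top_of_le_ne_top (ENNReal.natCast_ne_top (Fintype.card α)) ?_
  exact (lintegral_mono fun ω => entropy_le_card _).trans (by simp)

/-- Conditional probabilities converge almost surely, -x log x is continuous even at 0, and the
entropies are bounded. -/
lemma tendsto_finiteEntropy (P : ProbabilityMeasure (ℤ → α)) :
    Tendsto (finiteEntropy P) atTop (𝓝 (entropyRate P)) := by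
  have := Fintype.ofFinite α
  refine tendsto_lintegral_of_dominated_convergence (fun _ => (Fintype.card α : ℝ≥0∞))
    (fun t => (measurable_entropy_kernel _).comp (measurable_past t))
    (fun t => ae_of_all _ fun ω => entropy_le_card _) (by simp) ?_
  filter_upwards [ae_all_iff.2 (tendsto_condDistrib_past P)] with ω hω
  simp_rw [entropy_eq_sum]
  exact tendsto_finsetSum _ fun x _ => ENNReal.tendsto_ofReal
    ((Real.continuous_negMulLog.tendsto _).comp (hω x))

/-- The entropy per symbol of a stationary process converges to its entropy rate. -/
lemma tendsto_entropy_blockLaw {P : ProbabilityMeasure (ℤ → α)} (hP : P ∈ stationaryLaws α) :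
    Tendsto (fun n : ℕ => (n : ℝ≥0∞)⁻¹ * crossEntropy (blockLaw P n) (blockLaw P n)) atTop
      (𝓝 (entropyRate P)) := by
  simp_rw [entropy_blockLaw hP]
  exact tendsto_cesaro_ennreal (finiteEntropy_ne_top P) (entropyRate_ne_top P)
    (tendsto_finiteEntropy P)

end EntropyRate

/-! ### From universal coding to consistency. -/

section Consistency

/-- Either form of universality bounds the cross-entropy per symbol by the entropy per symbol,
up to a vanishing term. -/
lemma exists_tendsto_zero_crossEntropy_le {α : Type*} [MeasurableSpace α] [Finite α]
    [DiscreteMeasurableSpace α] (Q : ∀ n : ℕ, PMF (Fin n → α))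
    (P : ProbabilityMeasure (ℤ → α))
    (h : PerSymbolDivergenceVanishes Q P ∨ PerSymbolLogRatioVanishes Q P) :
    ∃ ε : ℕ → ℝ≥0∞, Tendsto ε atTop (𝓝 0) ∧ ∀ n : ℕ,
      (n : ℝ≥0∞)⁻¹ * crossEntropy (blockLaw P n) (Q n).toMeasure ≤
        ε n + (n : ℝ≥0∞)⁻¹ * crossEntropy (blockLaw P n) (blockLaw P n) := by
  rcases h with h | h
  · refine ⟨_, h, fun n => ?_⟩
    rw [← mul_add, klDiv_add_entropy]
  · refine ⟨_, h, fun n => ?_⟩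
    have hm : Measurable fun x : Fin n → α =>
        (ENNReal.log (blockLaw P n {x} / (Q n).toMeasure {x})).abs := .of_discrete
    have hint : ∫⁻ ω, (n : ℝ≥0∞)⁻¹ * (ENNReal.log (blockLaw P n {block n ω} /
          Q n (block n ω))).abs ∂(P : Measure (ℤ → α)) =
        (n : ℝ≥0∞)⁻¹ * ∫⁻ x, (ENNReal.log (blockLaw P n {x} / (Q n).toMeasure {x})).abs
          ∂(blockLaw P n) := by
      have hmap := lintegral_map (μ := (P : Measure (ℤ → α))) (hm.const_mul (n : ℝ≥0∞)⁻¹)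
        (measurable_block n)
      rw [← lintegral_const_mul _ hm]
      refine Eq.trans ?_ hmap.symm
      simp_rw [PMF.toMeasure_apply_singleton _ _ (MeasurableSet.of_discrete)]
    rw [hint, ← mul_add]
    gcongr
    exact crossEntropy_le_lintegral_abs_log_add _ _

variable {α : Type*} [MeasurableSpace α] [Finite α] [Nonempty α] [DiscreteMeasurableSpace α]

/-- For `n = 0` the estimate is the zero measure, hence `hn`. -/
lemma isProbabilityMeasure_cesaroEstimate (Q : ∀ n : ℕ, PMF (Fin n → α)) {n : ℕ} (hn : n ≠ 0)
    (a : Fin n → α) : IsProbabilityMeasure (cesaroEstimate Q n a) := by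
  constructor
  simp only [cesaroEstimate, Measure.smul_apply, Measure.coe_finsetSum, Finset.sum_apply,
    measure_univ, smul_eq_mul, Finset.sum_const, Finset.card_univ, Fintype.card_fin,
    nsmul_eq_mul, mul_one]
  exact ENNReal.inv_mul_cancel (by simpa) (ENNReal.natCast_ne_top n)

/-- The string consisting of the last `n` entries of an infinite past. -/
def recent {α : Type*} (n : ℕ) (a : ℕ → α) : Fin n → α := fun i => a (n - 1 - i)

lemma recent_infinitePast {α : Type*} (n : ℕ) (ω : ℤ → α) :
    recent n (infinitePast ω) = past n ω := by
  funext i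
  simp only [recent, infinitePast, past]
  congr 1
  omega

/-- The expected divergence plus the entropy rate is the expected self-information of `X_0`
under the estimate. -/
lemma lintegral_klDiv_add_entropyRate (Q : ∀ n : ℕ, PMF (Fin n → α))
    (P : ProbabilityMeasure (ℤ → α)) {n : ℕ} (hn : n ≠ 0) :
    (∫⁻ ω, klDiv (condDistrib (fun ω : ℤ → α => ω 0) infinitePast (P : Measure (ℤ → α))
        (infinitePast ω)) (cesaroEstimate Q n (past n ω)) ∂(P : Measure (ℤ → α))) +
      entropyRate P =
    ∫⁻ ω, selfInfo (cesaroEstimate Q n (past n ω) {ω 0}) ∂(P : Measure (ℤ → α)) := by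
  have := fun a => isProbabilityMeasure_cesaroEstimate Q hn a
  have hm : Measurable fun ω : ℤ → α => crossEntropy
      (condDistrib (fun ω : ℤ → α => ω 0) infinitePast (P : Measure (ℤ → α)) (infinitePast ω))
      (condDistrib (fun ω : ℤ → α => ω 0) infinitePast (P : Measure (ℤ → α)) (infinitePast ω)) :=
    (measurable_entropy_kernel _).comp measurable_infinitePast
  rw [entropyRate]
  refine (lintegral_add_right _ hm).symm.trans ?_
  have hrec : Measurable (recent (α := α) n) := by unfold recent; fun_prop
  -- The estimate sees only the finite past, a function of the infinite past, so disintegrating over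
  -- the latter replaces `y` by X_0.
  have key : ∀ g : (Fin n → α) × α → ℝ≥0∞,
      ∫⁻ ω, ∫⁻ y, g (past n ω, y) ∂(condDistrib (fun ω : ℤ → α => ω 0) infinitePast
        (P : Measure (ℤ → α)) (infinitePast ω)) ∂(P : Measure (ℤ → α)) =
      ∫⁻ ω, g (past n ω, ω 0) ∂(P : Measure (ℤ → α)) := by
    intro g
    have := lintegral_condDistrib (P : Measure (ℤ → α)) measurable_infinitePast
      (measurable_pi_apply (0 : ℤ)) ((Measurable.of_discrete (f := g)).comp
        ((hrec.comp measurable_fst).prodMk measurable_snd))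
    simpa only [Function.comp_apply, recent_infinitePast] using this
  refine Eq.trans (lintegral_congr fun ω => ?_)
    (key fun z => selfInfo (cesaroEstimate Q n z.1 {z.2}))
  exact klDiv_add_entropy _ _

lemma lintegral_selfInfo_cesaroEstimate_le (Q : ∀ n : ℕ, PMF (Fin n → α))
    {P : ProbabilityMeasure (ℤ → α)} (hP : P ∈ stationaryLaws α) {n : ℕ} (hn : n ≠ 0) :
    ∫⁻ ω, selfInfo (cesaroEstimate Q n (past n ω) {ω 0}) ∂(P : Measure (ℤ → α)) ≤
      (n : ℝ≥0∞)⁻¹ * crossEntropy (blockLaw P n) (Q n).toMeasure := by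
  have hm : ∀ t : Fin n, Measurable fun ω : ℤ → α =>
      selfInfo (conditional (Q n) t (past t ω) {ω 0}) := fun t =>
    (Measurable.of_discrete (f := fun z : (Fin (t : ℕ) → α) × α =>
      selfInfo (conditional (Q n) t z.1 {z.2}))).comp
      ((measurable_past t).prodMk (measurable_pi_apply 0))
  rw [crossEntropy_blockLaw hP, ← lintegral_finsetSum _ fun t _ => hm t,
    ← lintegral_const_mul _ (Finset.measurable_fun_sum _ fun t _ => hm t)]
  refine lintegral_mono fun ω => ?_
  simp only [cesaroEstimate, Measure.smul_apply, Measure.coe_finsetSum, Finset.sum_apply,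
    smul_eq_mul, suffix_past]
  exact selfInfo_average_le hn _ fun t => prob_le_one

end Consistency

end FiniteAlphabet

theorem theorem6 {α : Type*} [Finite α] [Nonempty α] [MeasurableSpace α]
    [DiscreteMeasurableSpace α] (Q : ∀ n : ℕ, PMF (Fin n → α))
    (hQ : ∀ P ∈ FiniteAlphabet.stationaryLaws α,
      FiniteAlphabet.PerSymbolDivergenceVanishes Q P ∨
        FiniteAlphabet.PerSymbolLogRatioVanishes Q P) :
    FiniteAlphabet.ConsistentInExpectedDivergence (FiniteAlphabet.cesaroEstimate Q)
      (FiniteAlphabet.stationaryLaws α) := by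
  intro P hP
  obtain ⟨ε, hε, hle⟩ := FiniteAlphabet.exists_tendsto_zero_crossEntropy_le Q P (hQ P hP)
  have hfin := FiniteAlphabet.entropyRate_ne_top P
  -- Finiteness of the entropy rate makes `ℝ≥0∞` subtraction continuous here.
  have hlim := ENNReal.Tendsto.sub (hε.add (FiniteAlphabet.tendsto_entropy_blockLaw hP))
    (tendsto_const_nhds (x := FiniteAlphabet.entropyRate P)) (Or.inr hfin)
  rw [zero_add, tsub_self] at hlim
  refine tendsto_of_tendsto_of_tendsto_of_le_of_le' tendsto_const_nhds hlim
    (Eventually.of_forall fun _ => zero_le) ?_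
  filter_upwards [eventually_gt_atTop 0] with n hn
  refine ENNReal.le_sub_of_add_le_right hfin ?_
  rw [FiniteAlphabet.lintegral_klDiv_add_entropyRate Q P hn.ne']
  exact (FiniteAlphabet.lintegral_selfInfo_cesaroEstimate_le Q hP hn.ne').trans (hle n)
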